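/- A category is *regular* if it has finite limits, every kernel pair has a coequalizer, and regular epimorphisms are stable under pullback; it is *geometric* if it is regular, well-powered, and for every object $c$ every family of subobjects of $c$ has a union (a supremum in the poset of subobjects of $c$), such unions being stable under pullback. The *geometric topology* $J_{\mathcal C}$ on a geometric category $\mathcal C$ is the Grothendieck topology whose covering sieves on $c$ are those containing a small family of arrows $\{f_i : c_i \to c\}_{i\in I}$ such that the union of the images of the $f_i$ is the whole of $c$. A family of arrows to $c$ is called covering if the sieve it generates is covering. A Grothendieck topos $\mathcal E$ is *localic* if it has a separating set of subterminal objects, i.e. there is a set $G$ of subterminal objects of $\mathcal E$ such that any two arrows $u,v : A \to B$ of $\mathcal E$ with $u\circ h = v\circ h$ for all $h : S \to A$ with $S\in G$ are equal. **Corollary 3.3.** Let $\mathcal C$ be a small geometric category and $J_{\mathcal C}$ the geometric topology on it. Then the topos $\mathbf{Sh}(\mathcal C, J_{\mathcal C})$ of sheaves of sets is localic if and only if for every object $c$ of $\mathcal C$ there exists a covering family of arrows $\{f_i : \mathrm{dom}(f_i) \to c\}_{i \in I}$ such that for every $i \in I$, every object $d$ of $\mathcal C$ and all arrows $g, h : d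 \to \mathrm{dom}(f_i)$, one has $f_i \circ g = f_i \circ h$. -/

import Mathlib

open CategoryTheory CategoryTheory.Limits

universe w v u

/-- A *geometric category*: a well-powered regular category in which every family of subobjects
of an object has a union (supremum), and unions are stable under pullback. -/
class GeometricCategory (C : Type u) [Category.{v} C] : Prop extends Regular C where
  wellPowered : WellPowered.{v} C
  exists_union : ∀ {X : C} (A : Set (Subobject X)), ∃ U : Subobject X, IsLUB A U
  pullback_union : ∀ {X Y : C} (f : X ⟶ Y) (A : Set (Subobject Y)) (U : Subobject Y),
    IsLUB A U → IsLUB ((Subobject.pullback f).obj '' A) ((Subobject.pullback f).obj U)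

/-- A family of arrows with common codomain `X` is *jointly covering* if the union of the images
of its members is the whole of `X`. -/
def IsJointlyCovering {C : Type u} [Category.{v} C] [HasImages C] {X : C} {ι : Type w}
    {Y : ι → C} (f : ∀ i, Y i ⟶ X) : Prop :=
  IsLUB (Set.range fun i => imageSubobject (f i)) (⊤ : Subobject X)

section GeometricTopology

variable {C : Type u} [Category.{v} C]

theorem imageSubobject_le_iff_factors [HasImages C] {X Y : C} (f : Y ⟶ X) (T : Subobject X) :
    imageSubobject f ≤ T ↔ T.Factors f := by
  constructor
  · intro h
    refine Subobject.factors_of_le f h ?_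
    have := imageSubobject_factors_comp_self f (𝟙 Y)
    simpa using this
  · intro h
    exact imageSubobject_le f (T.factorThru f h) (by simp)

theorem isJointlyCovering_iff [HasImages C] {X : C} {ι : Type w}
    {Y : ι → C} (f : ∀ i, Y i ⟶ X) :
    IsJointlyCovering f ↔ ∀ T : Subobject X, (∀ i, T.Factors (f i)) → T = ⊤ := by
  constructor
  · intro h T hT
    refine top_le_iff.1 (h.2 ?_)
    rintro _ ⟨i, rfl⟩
    exact (imageSubobject_le_iff_factors _ _).2 (hT i)
  · intro h
    refine ⟨fun _ _ => le_top, fun T hT => ?_⟩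
    rw [h T fun i => (imageSubobject_le_iff_factors _ _).1 (hT ⟨i, rfl⟩)]

/-- Images in a regular category are stable under pullback. -/
theorem imageSubobject_pullback_snd [Regular C] {X Y Z : C} (f : Y ⟶ X) (g : Z ⟶ X) :
    imageSubobject (pullback.snd f g) = (Subobject.pullback g).obj (imageSubobject f) := by
  apply le_antisymm
  · rw [imageSubobject_le_iff_factors, pullback_factors_iff, ← pullback.condition]
    exact imageSubobject_factors_comp_self _ _
  · set T := imageSubobject (pullback.snd f g) with hT
    have hTf : T.Factors (pullback.snd f g) := (imageSubobject_le_iff_factors _ _).1 le_rfl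
    have hpb := IsPullback.of_hasPullback (image.ι f) g
    have e1 : (Subobject.pullback g).obj (imageSubobject f) =
        Subobject.mk (pullback.snd (image.ι f) g) := Subobject.pullback_obj_mk hpb
    rw [e1]
    let p := pullback.fst (image.ι f) g
    let q := pullback.snd (factorThruImage f) p
    have : IsRegularEpi (factorThruImage f) := inferInstance
    have : IsRegularEpi q := inferInstance
    have : StrongEpi q := inferInstance
    let t : pullback (factorThruImage f) p ⟶ pullback f g :=
      pullback.lift (pullback.fst _ _) (q ≫ pullback.snd (image.ι f) g) (by
        rw [Category.assoc, ← pullback.condition, ← Category.assoc, ← pullback.condition,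
          Category.assoc, image.fac])
    have sq : CommSq (t ≫ T.factorThru _ hTf) q T.arrow (pullback.snd (image.ι f) g) :=
      ⟨by simp [t, pullback.lift_snd]⟩
    exact Subobject.mk_le_of_comm sq.lift sq.fac_right

/-- The *geometric topology* on a geometric category: a sieve is covering when it contains a small
jointly covering family. -/
def geometricTopology (C : Type u) [Category.{v} C] [GeometricCategory C] :
    GrothendieckTopology C where
  sieves X := {S | ∃ (ι : Type v) (Y : ι → C) (f : ∀ i, Y i ⟶ X),
    IsJointlyCovering f ∧ ∀ i, S (f i)}
  top_mem' X := by
    refine ⟨PUnit, fun _ => X, fun _ => 𝟙 X, ?_, fun _ => trivial⟩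
    rw [isJointlyCovering_iff]
    intro T hT
    refine top_le_iff.1 ?_
    rw [Subobject.top_eq_id]
    exact Subobject.mk_le_of_comm (T.factorThru _ (hT ⟨⟩)) (by simp)
  pullback_stable' := by
    rintro X Z S g ⟨ι, Y, f, hf, hS⟩
    refine ⟨ι, fun i => pullback (f i) g, fun i => pullback.snd (f i) g, ?_, fun i => ?_⟩
    · have h := GeometricCategory.pullback_union g _ _ hf
      rw [Subobject.pullback_top, ← Set.range_comp] at h
      unfold IsJointlyCovering
      convert h using 2
      funext i
      exact imageSubobject_pullback_snd (f i) g
    · change S (pullback.snd (f i) g ≫ g)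
      rw [← pullback.condition]
      exact S.downward_closed (hS i) _
  transitive' := by
    rintro X S ⟨ι, Y, f, hf, hS⟩ R hR
    choose κ Z g hg hgR using fun i => hR (hS i)
    refine ⟨Σ i, κ i, fun a => Z a.1 a.2, fun a => g a.1 a.2 ≫ f a.1, ?_, fun a => hgR a.1 a.2⟩
    rw [isJointlyCovering_iff] at hf ⊢
    intro T hT
    refine hf T fun i => ?_
    have h := (isJointlyCovering_iff _).1 (hg i) ((Subobject.pullback (f i)).obj T) fun j =>
      (pullback_factors_iff _ _ _).2 (hT ⟨i, j⟩)
    have h2 := (pullback_factors_iff (f i) T (𝟙 (Y i))).1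
      (h ▸ Subobject.top_factors _)
    simpa using h2

end GeometricTopology

/-- A category (in practice, a Grothendieck topos) is *localic* if it has a separating (small) set
of subterminal objects. -/
def IsLocalicTopos (E : Type u) [Category.{v} E] : Prop :=
  ∃ (ι : Type v) (S : ι → E),
    (∀ i, IsSubterminal (S i)) ∧ (ObjectProperty.ofObj S).IsSeparating

/-! On any site, let R be the sieve of arrows into `c` that equalize all parallel pairs; the
criterion says that R covers `c`. An arrow f lies in R exactly when the image of `yoneda.map f` has
at most one section over each object, so its sheafification is subterminal. If every R covers, these
images separate sheaves (`isLocalicTopos_of_constantArrowSieve_mem`). Conversely, when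
representables are separated, a map from a subterminal sheaf to the sheafified representable of `c`
is locally given by arrows in R; so the inclusion of R sheafifies to an epimorphism and R covers
(`constantArrowSieve_mem_of_isLocalicTopos`). -/

open Opposite

section Site

variable {C : Type u} [SmallCategory.{u} C] (J : GrothendieckTopology C)

/-- The sieve of arrows `f` into `c` which equalize every parallel pair of arrows into their
domain. -/
def constantArrowSieve (c : C) : Sieve c where
  arrows Y f := ∀ (d : C) (g h : d ⟶ Y), g ≫ f = h ≫ f
  downward_closed := by
    intro Y Z f hf k d g h
    simpa using hf d (g ≫ k) (h ≫ k)

variable {J}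

/-- By Yoneda, sections over `d` correspond to maps out of the sheafified representable of `d`. -/
theorem CategoryTheory.IsSubterminal.subsingleton_sections {S : Sheaf J (Type u)} (hS : IsSubterminal S)
    (d : C) : Subsingleton (S.obj.obj (op d)) := by
  refine ⟨fun s t => yonedaEquiv.symm.injective ?_⟩
  have h := hS (Z := (presheafToSheaf J (Type u)).obj (yoneda.obj d))
    ⟨sheafifyLift J (yonedaEquiv.symm s) S.property⟩
    ⟨sheafifyLift J (yonedaEquiv.symm t) S.property⟩
  have h' := congrArg (fun k => toSheafify J (yoneda.obj d) ≫ k.hom) h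
  simpa using h'

theorem CategoryTheory.Sheaf.ext_of_mem (F : Sheaf J (Type u)) {X : C} {T : Sieve X} (hT : T ∈ J X)
    {x y : F.obj.obj (op X)}
    (h : ∀ ⦃Y : C⦄ (f : Y ⟶ X), T f → F.obj.map f.op x = F.obj.map f.op y) : x = y :=
  (((isSheaf_iff_isSheaf_of_type _ _).1 F.property).isSeparated _ hT).ext h

/-- The sheafification of a presheaf with at most one section over each object is subterminal. -/
theorem isSubterminal_presheafToSheaf_obj (P : Cᵒᵖ ⥤ Type u)
    (hP : ∀ d : C, Subsingleton (P.obj (op d))) :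
    IsSubterminal ((presheafToSheaf J (Type u)).obj P) := by
  intro Z f g
  ext ⟨d⟩ z
  refine Sheaf.ext_of_mem _ (J.intersection_covering
    (Presheaf.imageSieve_mem J (toSheafify J P) (f.hom.app (op d) z))
    (Presheaf.imageSieve_mem J (toSheafify J P) (g.hom.app (op d) z))) ?_
  rintro e k ⟨⟨s, hs⟩, ⟨t, ht⟩⟩
  have := hP e
  exact hs.symm.trans ((congrArg _ (Subsingleton.elim s t)).trans ht)

theorem isLocalicTopos_of_constantArrowSieve_mem (H : ∀ c : C, constantArrowSieve c ∈ J c) :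
    IsLocalicTopos (Sheaf J (Type u)) := by
  let P : (Σ (c : C) (d : C), {f : d ⟶ c // constantArrowSieve c f}) → Cᵒᵖ ⥤ Type u :=
    fun a => (Subfunctor.range (yoneda.map a.2.2.1)).toFunctor
  refine ⟨_, fun a => (presheafToSheaf J (Type u)).obj (P a), fun a => ?_, ?_⟩
  · refine isSubterminal_presheafToSheaf_obj _ fun e => ⟨?_⟩
    rintro ⟨_, g, rfl⟩ ⟨_, h, rfl⟩
    exact Subtype.ext (a.2.2.2 e g h)
  · intro A B u v huv
    ext ⟨c⟩ x
    refine Sheaf.ext_of_mem _ (H c) fun d f hf => ?_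
    let a : Σ (c : C) (d : C), {f : d ⟶ c // constantArrowSieve c f} := ⟨c, d, f, hf⟩
    -- The section `x`, viewed as a map from the representable of `c`, restricted to the image of
    -- `f`; at `f` itself its value is the restriction of `x` along `f`.
    let η : P a ⟶ A.obj := (Subfunctor.range (yoneda.map f)).ι ≫ yonedaEquiv.symm x
    have h := huv _ ⟨a⟩ ⟨sheafifyLift J η A.property⟩
    have h' := congrArg (fun k => toSheafify J (P a) ≫ k.hom) h
    have h'' : η ≫ u.hom = η ≫ v.hom := by simpa using h'
    have hx : η.app (op d) ⟨f, 𝟙 d, Category.id_comp f⟩ = A.obj.map f.op x := rfl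
    have key := congrArg (fun k => k.app (op d) ⟨f, 𝟙 d, Category.id_comp f⟩) h''
    have key' : u.hom.app (op d) (A.obj.map f.op x) = v.hom.app (op d) (A.obj.map f.op x) := key
    rw [NatTrans.naturality_apply, NatTrans.naturality_apply] at key'
    exact key'

theorem constantArrowSieve_mem_of_isLocalicTopos
    (hsep : ∀ c : C, Presieve.IsSeparated J (yoneda.obj c))
    (H : IsLocalicTopos (Sheaf J (Type u))) (c : C) : constantArrowSieve c ∈ J c := by
  obtain ⟨ι, S, hS, hG⟩ := H
  let R := constantArrowSieve c
  have hepi : Epi ((presheafToSheaf J (Type u)).map R.functorInclusion) := by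
    refine ⟨fun {B} p q hpq => hG _ _ ?_⟩
    have hpq' : R.functorInclusion ≫ toSheafify J _ ≫ p.hom =
        R.functorInclusion ≫ toSheafify J _ ≫ q.hom := by
      have := congrArg (fun k => toSheafify J R.functor ≫ k.hom) hpq
      simpa [← toSheafify_naturality_assoc] using this
    rintro _ ⟨i⟩ h
    ext ⟨d⟩ s
    refine Sheaf.ext_of_mem _
      (Presheaf.imageSieve_mem J (toSheafify J (yoneda.obj c)) (h.hom.app (op d) s)) ?_
    rintro e k ⟨f, hf⟩
    -- After sheafification both composites become images under `h` of sections of the subterminal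
    -- `S i`, hence agree. They are therefore locally equal, and separatedness makes them equal.
    have hR : R f := by
      intro e' g g'
      let a (g : e' ⟶ e) : (yoneda.obj c).obj (op e') := (yoneda.obj c).map g.op f
      change a g = a g'
      suffices hmem : Presheaf.equalizerSieve (F := yoneda.obj c) (a g) (a g') ∈ J e' from
        (hsep c _ hmem).ext fun _ _ hk => hk
      refine Presheaf.equalizerSieve_mem J (toSheafify J (yoneda.obj c)) (a g) (a g') ?_
      have : Subsingleton ((S i).obj.obj (op e')) := (hS i).subsingleton_sections e'
      have aux (g : e' ⟶ e) : (toSheafify J (yoneda.obj c)).app (op e') (a g) =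
          h.hom.app (op e') ((S i).obj.map (g ≫ k).op s) := by
        refine (NatTrans.naturality_apply (toSheafify J (yoneda.obj c)) g.op f).trans ?_
        rw [hf, NatTrans.naturality_apply, op_comp, Functor.map_comp]
        rfl
      rw [aux, aux]
      exact congrArg _ (Subsingleton.elim _ _)
    have key : p.hom.app (op e) ((toSheafify J (yoneda.obj c)).app (op e) f) =
        q.hom.app (op e) ((toSheafify J (yoneda.obj c)).app (op e) f) :=
      congrArg (fun k => k.app (op e) ⟨f, hR⟩) hpq'
    rw [hf, NatTrans.naturality_apply, NatTrans.naturality_apply] at key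
    exact key
  have hsurj : Presheaf.IsLocallySurjective J R.functorInclusion := by
    rw [← Presheaf.isLocallySurjective_presheafToSheaf_map_iff]
    exact (Sheaf.isLocallySurjective_iff_epi _).2 hepi
  -- If the identity of `c`, restricted along `f`, lifts to R, the lift is `f` itself.
  refine J.superset_covering ?_
    (Presheaf.imageSieve_mem J R.functorInclusion (U := op c) (𝟙 c))
  rintro d f ⟨⟨t, ht⟩, htf⟩
  have : t = f := htf.trans (Category.comp_id f)
  exact this ▸ ht

end Site

/-- The equalizer of two arrows that agree on a jointly covering family is a subobject through which
the family factors, hence is everything. -/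
theorem isSeparated_geometricTopology_yoneda {C : Type u} [Category.{v} C] [GeometricCategory C]
    (c : C) : Presieve.IsSeparated (geometricTopology C) (yoneda.obj c) := by
  rintro X T ⟨ι, Y, f, hf, hT⟩ x (g : X ⟶ c) (h : X ⟶ c) hg hh
  have htop := (isJointlyCovering_iff f).1 hf (equalizerSubobject g h) fun i =>
    (equalizerSubobject_factors_iff g h (f i)).2 ((hg _ (hT i)).trans (hh _ (hT i)).symm)
  have h1 := (equalizerSubobject_factors_iff g h (𝟙 X)).1 (htop ▸ Subobject.top_factors _)
  simpa using h1

theorem corollary3p3 {C : Type u} [SmallCategory.{u} C] [GeometricCategory C] :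
    IsLocalicTopos (Sheaf (geometricTopology C) (Type u)) ↔
      ∀ c : C, ∃ (ι : Type u) (Y : ι → C) (f : ∀ i, Y i ⟶ c),
        Sieve.ofArrows Y f ∈ geometricTopology C c ∧
          ∀ (i : ι) (d : C) (g h : d ⟶ Y i), g ≫ f i = h ≫ f i := by
  constructor
  · intro H c
    refine ⟨Σ d : C, {f : d ⟶ c // constantArrowSieve c f}, fun a => a.1, fun a => a.2.1, ?_,
      fun a => a.2.2⟩
    refine (geometricTopology C).superset_covering ?_
      (constantArrowSieve_mem_of_isLocalicTopos isSeparated_geometricTopology_yoneda H c)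
    intro d f hf
    exact Sieve.ofArrows_mk _ _ (⟨d, f, hf⟩ : Σ d : C, {f : d ⟶ c // constantArrowSieve c f})
  · intro H
    refine isLocalicTopos_of_constantArrowSieve_mem fun c => ?_
    obtain ⟨ι, Y, f, hf, hc⟩ := H c
    refine (geometricTopology C).superset_covering ?_ hf
    rw [Sieve.ofArrows, Sieve.generate_le_iff]
    rintro _ _ ⟨i⟩
    exact hc i
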